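/- Let $\mathcal{O}$ be an order of a quartic number field, with a normalized $\mathbb{Z}$-basis $\{1,\omega_1,\omega_2,\omega_3\}$: writing $\omega_i\omega_j=c_{ij}^{(0)}+c_{ij}^{(1)}\omega_1+c_{ij}^{(2)}\omega_2+c_{ij}^{(3)}\omega_3$ with $c_{ij}^{(k)}\in\mathbb{Z}$, normalized means $c_{12}^{(1)}=c_{12}^{(2)}=c_{13}^{(1)}=0$. Put $$\ell=c_{13}^{(3)}-c_{11}^{(1)},\qquad m=c_{33}^{(3)}-c_{23}^{(2)},\qquad n=c_{22}^{(2)}-c_{23}^{(3)}.$$ A pair of integral ternary quadratic forms $\mathcal{Q}_A=a_{11}x^2+a_{12}xy+a_{13}xz+a_{22}y^2+a_{23}yz+a_{33}z^2=(a_{11},a_{12},a_{13},a_{22},a_{23},a_{33})$ and $\mathcal{Q}_B=(b_{11},b_{12},b_{13},b_{22},b_{23},b_{33})$ *parametrizes* $\mathcal{O}$ (with this basis) if $c_{12}^{(1)}=c_{12}^{(2)}=c_{13}^{(1)}=0$ and $$\begin{aligned} c_{11}^{(1)}&=a_{13}b_{12}-a_{12}b_{13}+a_{23}b_{11}-a_{11}b_{23},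 & c_{11}^{(2)}&=a_{11}b_{13}-a_{13}b_{11}, & c_{11}^{(3)}&=a_{12}b_{11}-a_{11}b_{12},\\ c_{12}^{(3)}&=a_{22}b_{11}-a_{11}b_{22}, & c_{13}^{(2)}&=a_{11}b_{33}-a_{33}b_{11}, & c_{13}^{(3)}&=a_{23}b_{11}-a_{11}b_{23},\\ c_{22}^{(1)}&=a_{23}b_{22}-a_{22}b_{23}, & c_{22}^{(2)}&=a_{12}b_{23}-a_{23}b_{12}+a_{22}b_{13}-a_{13}b_{22}, & c_{22}^{(3)}&=a_{22}b_{12}-a_{12}b_{22},\\ c_{23}^{(1)}&=a_{33}b_{22}-a_{22}b_{33}, & c_{23}^{(2)}&=a_{12}b_{33}-a_{33}b_{12}, & c_{23}^{(3)}&=a_{22}b_{13}-a_{13}b_{22},\\ c_{33}^{(1)}&=a_{33}b_{23}-a_{23}b_{33}, & c_{33}^{(2)}&=a_{13}b_{33}-a_{33}b_{13}, & c_{33}^{(3)}&=a_{12}b_{33}-a_{33}b_{12}+a_{23}b_{13}-a_{13}b_{23}, \end{aligned}$$ together with (using the vanishing of $c_{12}^{(1)},c_{12}^{(2)},c_{13}^{(1)}$)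 $$\begin{aligned} c_{11}^{(0)}&=c_{12}^{(3)}c_{13}^{(2)}-c_{11}^{(2)}c_{22}^{(2)}-c_{11}^{(3)}c_{23}^{(2)}, & c_{12}^{(0)}&=c_{11}^{(2)}c_{22}^{(1)}+c_{11}^{(3)}c_{23}^{(1)}, & c_{13}^{(0)}&=c_{11}^{(2)}c_{23}^{(1)}+c_{11}^{(3)}c_{33}^{(1)},\\ c_{22}^{(0)}&=c_{12}^{(3)}c_{23}^{(1)}-c_{11}^{(1)}c_{22}^{(1)}, & c_{23}^{(0)}&=c_{12}^{(3)}c_{33}^{(1)}-c_{11}^{(1)}c_{23}^{(1)}, & c_{33}^{(0)}&=(c_{13}^{(3)}-c_{11}^{(1)})c_{33}^{(1)}+c_{13}^{(2)}c_{23}^{(1)}. \end{aligned}$$ A matrix over $\mathbb{Z}$ is in *row-style Hermite normal form* if it is in row echelon form with zero rows at the bottom, every leading entry is positive, and every entry $e$ above a leading entry $p$ satisfies $0\le e<p$; a row-style Hermite normal form of a matrix $N$ is such a matrix of the form $PN$ with $P$ unimodular. Consider the following algorithm. 1. Let $t=1$ if $\ell\neq0$; $t=2$ if $\ell=0$ and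 $c_{11}^{(2)}\ne0$; $t=3$ if $\ell=c_{11}^{(2)}=0$ and $c_{11}^{(3)}\neq0$; $t=4$ if $\ell=c_{11}^{(2)}=c_{11}^{(3)}=0$ and $c_{12}^{(3)}\ne0$. 2. Let $M_t$ be the corresponding one of $$M_1=\begin{pmatrix}-\ell&c_{11}^{(2)}&c_{11}^{(3)}&0&0&0\\0&c_{23}^{(3)}&-c_{22}^{(3)}&-\ell&0&0\\0&m&n&0&-\ell&0\\0&-c_{33}^{(2)}&c_{23}^{(2)}&0&0&-\ell\end{pmatrix},\quad M_2=\begin{pmatrix}0&-c_{11}^{(2)}&-c_{11}^{(3)}&0&0&0\\c_{23}^{(3)}&0&-c_{12}^{(3)}&-c_{11}^{(2)}&0&0\\m&0&-c_{13}^{(3)}&0&-c_{11}^{(2)}&0\\-c_{33}^{(2)}&0&c_{13}^{(2)}&0&0&-c_{11}^{(2)}\end{pmatrix},$$ $$M_3=\begin{pmatrix}0&0&c_{11}^{(3)}&0&0&0\\c_{22}^{(3)}&-c_{12}^{(3)}&0&c_{11}^{(3)}&0&0\\-n&-c_{13}^{(3)}&0&0&c_{11}^{(3)}&0\\-c_{23}^{(2)}&c_{13}^{(2)}&0&0&0&c_{11}^{(3)}\end{pmatrix},\quad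 M_4=\begin{pmatrix}-c_{22}^{(3)}&c_{12}^{(3)}&0&0&0&0\\-c_{23}^{(3)}&0&c_{12}^{(3)}&0&0&0\\c_{22}^{(1)}&0&0&-c_{13}^{(3)}&c_{12}^{(3)}&0\\c_{23}^{(1)}&0&0&c_{13}^{(2)}&0&c_{12}^{(3)}\end{pmatrix}.$$ 3. Compute the row-style Hermite normal form $(U\mid V)$ of the $6\times10$ matrix $(M_t^{\top}\mid I_6)$, where $V=(v_{ij})$ is $6\times 6$. 4. Let $k$ be $\dfrac{\ell}{v_{52}v_{63}-v_{53}v_{62}}$, $\dfrac{c_{11}^{(2)}}{v_{51}v_{63}}$, $\dfrac{-c_{11}^{(3)}}{v_{51}v_{62}}$, $\dfrac{-c_{12}^{(3)}}{v_{51}v_{64}}$ for $t=1,2,3,4$ respectively. 5. Output $\mathcal{Q}_A=k\,(v_{51},v_{52},v_{53},v_{54},v_{55},v_{56})$ and $\mathcal{Q}_B=(0,v_{62},v_{63},v_{64},v_{65},v_{66})$. This algorithm is well defined and correct: exactly one of the four cases in step 1 occurs; a row-style Hermite normal form in step 3 exists; and for every row-style Hermite normal form $(U\mid V)$ of $(M_t^\top\mid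 I_6)$ one has $V\in\mathrm{GL}_6(\mathbb{Z})$, the denominator in step 4 is nonzero, $k$ is an integer, and the output pair $(\mathcal{Q}_A,\mathcal{Q}_B)$ parametrizes $\mathcal{O}$ with the given basis. -/

import Mathlib

/-- An order of a number field `K`: a subring which is finitely generated as a `ℤ`-module and
spans `K` over `ℚ`. -/
def IsOrderIn {K : Type*} [Field K] [NumberField K] (O : Subring K) : Prop :=
  Module.Finite ℤ O ∧ Submodule.span ℚ (O : Set K) = ⊤

/-- The coefficients `c_{ij}^{(k)}` of the multiplication table of a `ℤ`-basis
`ω₀, ω₁, ω₂, ω₃`, that is `ω_i ω_j = ∑ₖ c_{ij}^{(k)} ω_k`; we write `c i j k` for `c_{ij}^{(k)}`. -/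
noncomputable def mulCoeff {R : Type*} [CommRing R] (ω : Module.Basis (Fin 4) ℤ R) :
    Fin 4 → Fin 4 → Fin 4 → ℤ :=
  fun i j k => ω.repr (ω i * ω j) k

/-- A basis `1, ω₁, ω₂, ω₃` is normalized if
`c_{12}^{(1)} = c_{12}^{(2)} = c_{13}^{(1)} = 0`. -/
def IsNormalizedBasis {R : Type*} [CommRing R] (ω : Module.Basis (Fin 4) ℤ R) : Prop :=
  ω 0 = 1 ∧ mulCoeff ω 1 2 1 = 0 ∧ mulCoeff ω 1 2 2 = 0 ∧ mulCoeff ω 1 3 1 = 0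

/-- The integral ternary quadratic form
`c11 x² + c12 xy + c13 xz + c22 y² + c23 yz + c33 z²`. -/
structure TernaryQuadraticForm where
  c11 : ℤ
  c12 : ℤ
  c13 : ℤ
  c22 : ℤ
  c23 : ℤ
  c33 : ℤ

/-- The integers `c i j k = c_{ij}^{(k)}` (`1 ≤ i ≤ j ≤ 3`, `0 ≤ k ≤ 3`) are the coefficients of
the multiplication table attached to the pair of ternary quadratic forms `(a, b)`.  The constant
coefficients `c_{ij}^{(0)}` are those forced by associativity. -/
structure IsTableOfPair (a b : TernaryQuadraticForm) (c : Fin 4 → Fin 4 → Fin 4 → ℤ) : Prop where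
  c11_1 : c 1 1 1 = a.c13 * b.c12 - a.c12 * b.c13 + a.c23 * b.c11 - a.c11 * b.c23
  c11_2 : c 1 1 2 = a.c11 * b.c13 - a.c13 * b.c11
  c11_3 : c 1 1 3 = a.c12 * b.c11 - a.c11 * b.c12
  c12_1 : c 1 2 1 = 0
  c12_2 : c 1 2 2 = 0
  c12_3 : c 1 2 3 = a.c22 * b.c11 - a.c11 * b.c22
  c13_1 : c 1 3 1 = 0
  c13_2 : c 1 3 2 = a.c11 * b.c33 - a.c33 * b.c11
  c13_3 : c 1 3 3 = a.c23 * b.c11 - a.c11 * b.c23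
  c22_1 : c 2 2 1 = a.c23 * b.c22 - a.c22 * b.c23
  c22_2 : c 2 2 2 = a.c12 * b.c23 - a.c23 * b.c12 + a.c22 * b.c13 - a.c13 * b.c22
  c22_3 : c 2 2 3 = a.c22 * b.c12 - a.c12 * b.c22
  c23_1 : c 2 3 1 = a.c33 * b.c22 - a.c22 * b.c33
  c23_2 : c 2 3 2 = a.c12 * b.c33 - a.c33 * b.c12
  c23_3 : c 2 3 3 = a.c22 * b.c13 - a.c13 * b.c22
  c33_1 : c 3 3 1 = a.c33 * b.c23 - a.c23 * b.c33
  c33_2 : c 3 3 2 = a.c13 * b.c33 - a.c33 * b.c13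
  c33_3 : c 3 3 3 = a.c12 * b.c33 - a.c33 * b.c12 + a.c23 * b.c13 - a.c13 * b.c23
  c11_0 : c 1 1 0 = (c 1 2 2 - c 1 1 1) * c 1 2 2 + c 1 2 3 * c 1 3 2
      + c 1 1 2 * (c 1 2 1 - c 2 2 2) - c 1 1 3 * c 2 3 2
  c12_0 : c 1 2 0 = c 1 1 2 * c 2 2 1 + c 1 1 3 * c 2 3 1 - c 1 2 1 * c 1 2 2
      - c 1 2 3 * c 1 3 1
  c13_0 : c 1 3 0 = c 1 1 2 * c 2 3 1 + c 1 1 3 * c 3 3 1 - c 1 2 1 * c 1 3 2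
      - c 1 3 1 * c 1 3 3
  c22_0 : c 2 2 0 = (c 1 2 1 + c 1 2 2 - c 1 1 1) * c 2 2 1 + c 1 2 3 * c 2 3 1
      - c 1 2 1 * c 2 2 2 - c 1 3 1 * c 2 2 3
  c23_0 : c 2 3 0 = c 1 2 1 * (c 1 3 1 - c 2 3 2) - c 1 1 1 * c 2 3 1 + c 1 2 2 * c 2 3 1
      - c 1 3 1 * c 2 3 3 + c 1 2 3 * c 3 3 1
  c33_0 : c 3 3 0 = (c 1 3 3 - c 1 1 1) * c 3 3 1 + c 1 3 1 * (c 1 3 1 - c 3 3 3)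
      + c 1 3 2 * c 2 3 1 - c 1 2 1 * c 3 3 2

/-- The pair `(a, b)` parametrizes the commutative ring `R` through the `ℤ`-basis
`1, ω₁, ω₂, ω₃` of `R`: the multiplication table of this basis is the one attached to `(a, b)`. -/
def Parametrizes (a b : TernaryQuadraticForm) {R : Type*} [CommRing R]
    (ω : Module.Basis (Fin 4) ℤ R) : Prop :=
  ω 0 = 1 ∧ IsTableOfPair a b (mulCoeff ω)

/-- The entry `(i, j)` is the leading (leftmost nonzero) entry of row `i` of `H`. -/
def IsLeadingEntry {m n : ℕ} (H : Matrix (Fin m) (Fin n) ℤ) (i : Fin m) (j : Fin n) : Prop :=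
  H i j ≠ 0 ∧ ∀ j' < j, H i j' = 0

/-- Row-style Hermite normal form: row echelon form (leading entries move strictly to the right
as one goes down, zero rows at the bottom), positive leading entries, and entries above a leading
entry are nonnegative and smaller than it. -/
structure IsRowHermite {m n : ℕ} (H : Matrix (Fin m) (Fin n) ℤ) : Prop where
  echelon : ∀ i i' j', i < i' → IsLeadingEntry H i' j' → ∃ j < j', IsLeadingEntry H i j
  pos : ∀ i j, IsLeadingEntry H i j → 0 < H i j
  reduced : ∀ i j, IsLeadingEntry H i j → ∀ i' < i, 0 ≤ H i' j ∧ H i' j < H i j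

/-- `H` is the row-style Hermite normal form of `A`. -/
def IsRowHermiteFormOf {m n : ℕ} (H A : Matrix (Fin m) (Fin n) ℤ) : Prop :=
  IsRowHermite H ∧ ∃ P : Matrix (Fin m) (Fin m) ℤ, IsUnit P.det ∧ H = P * A

/-- The block matrix `(U ∣ V)`. -/
def beside {m p q : ℕ} (U : Matrix (Fin m) (Fin p) ℤ) (V : Matrix (Fin m) (Fin q) ℤ) :
    Matrix (Fin m) (Fin (p + q)) ℤ :=
  (Matrix.fromCols U V).submatrix id finSumFinEquiv.symm

namespace QuarticAlgorithm

/-- The integer `ℓ`. -/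
def ell (c : Fin 4 → Fin 4 → Fin 4 → ℤ) : ℤ := c 1 3 3 - c 1 1 1

/-- The integer `m`. -/
def emm (c : Fin 4 → Fin 4 → Fin 4 → ℤ) : ℤ := c 3 3 3 - c 2 3 2

/-- The integer `n`. -/
def enn (c : Fin 4 → Fin 4 → Fin 4 → ℤ) : ℤ := c 2 2 2 - c 2 3 3

/-- The four cases `t = 1, 2, 3, 4` of the algorithm. -/
inductive CaseIndex
  | one
  | two
  | three
  | four

/-- The condition under which the algorithm selects the case `t`. -/
def IsCase (c : Fin 4 → Fin 4 → Fin 4 → ℤ) : CaseIndex → Prop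
  | .one => ell c ≠ 0
  | .two => ell c = 0 ∧ c 1 1 2 ≠ 0
  | .three => ell c = 0 ∧ c 1 1 2 = 0 ∧ c 1 1 3 ≠ 0
  | .four => ell c = 0 ∧ c 1 1 2 = 0 ∧ c 1 1 3 = 0 ∧ c 1 2 3 ≠ 0

/-- The matrices `M₁, M₂, M₃, M₄`. -/
def matrixM (c : Fin 4 → Fin 4 → Fin 4 → ℤ) : CaseIndex → Matrix (Fin 4) (Fin 6) ℤ
  | .one =>
    !![-ell c, c 1 1 2, c 1 1 3, 0, 0, 0;
       0, c 2 3 3, -c 2 2 3, -ell c, 0, 0;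
       0, emm c, enn c, 0, -ell c, 0;
       0, -c 3 3 2, c 2 3 2, 0, 0, -ell c]
  | .two =>
    !![0, -c 1 1 2, -c 1 1 3, 0, 0, 0;
       c 2 3 3, 0, -c 1 2 3, -c 1 1 2, 0, 0;
       emm c, 0, -c 1 3 3, 0, -c 1 1 2, 0;
       -c 3 3 2, 0, c 1 3 2, 0, 0, -c 1 1 2]
  | .three =>
    !![0, 0, c 1 1 3, 0, 0, 0;
       c 2 2 3, -c 1 2 3, 0, c 1 1 3, 0, 0;
       -enn c, -c 1 3 3, 0, 0, c 1 1 3, 0;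
       -c 2 3 2, c 1 3 2, 0, 0, 0, c 1 1 3]
  | .four =>
    !![-c 2 2 3, c 1 2 3, 0, 0, 0, 0;
       -c 2 3 3, 0, c 1 2 3, 0, 0, 0;
       c 2 2 1, 0, 0, -c 1 3 3, c 1 2 3, 0;
       c 2 3 1, 0, 0, c 1 3 2, 0, c 1 2 3]

/-- The numerator of `k`. -/
def numK (c : Fin 4 → Fin 4 → Fin 4 → ℤ) : CaseIndex → ℤ
  | .one => ell c
  | .two => c 1 1 2
  | .three => -c 1 1 3
  | .four => -c 1 2 3

/-- The denominator of `k`.  Rows and columns of `V` are numbered from `0` here, so that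
`v_{ij}` is `V (i - 1) (j - 1)`. -/
def denK (V : Matrix (Fin 6) (Fin 6) ℤ) : CaseIndex → ℤ
  | .one => V 4 1 * V 5 2 - V 4 2 * V 5 1
  | .two => V 4 0 * V 5 2
  | .three => V 4 0 * V 5 1
  | .four => V 4 0 * V 5 3

/-- The output form `Q_A = k (v₅₁, v₅₂, v₅₃, v₅₄, v₅₅, v₅₆)`. -/
def formA (k : ℤ) (V : Matrix (Fin 6) (Fin 6) ℤ) : TernaryQuadraticForm :=
  ⟨k * V 4 0, k * V 4 1, k * V 4 2, k * V 4 3, k * V 4 4, k * V 4 5⟩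

/-- The output form `Q_B = (0, v₆₂, v₆₃, v₆₄, v₆₅, v₆₆)`. -/
def formB (V : Matrix (Fin 6) (Fin 6) ℤ) : TernaryQuadraticForm :=
  ⟨0, V 5 1, V 5 2, V 5 3, V 5 4, V 5 5⟩

end QuarticAlgorithm

/-!
Write the coefficients of a ternary quadratic form as a vector in `ℤ⁶`. A pair `(a, b)` has the
bivector `a ∧ b`, with the `15` minors `aᵢ bⱼ - aⱼ bᵢ` as entries, and it parametrizes a
normalized basis exactly when these minors are certain linear expressions in the coefficients
`c_{ij}^{(k)}`, `k ≥ 1`, of the multiplication table, and the constant coefficients `c_{ij}^{(0)}`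
are the ones which associativity forces in any case (`IsNormalizedTable.constant_coeffs`). Read
backwards, the multiplication table defines a bivector `p` (`tableBivector`), and the task is to
write `p` as a product `k v ∧ w` of integral vectors.

Associativity of the multiplication implies that `p` satisfies the three-term Plücker relations
(`IsNormalizedTable.plucker_relations`), that is, `p` is decomposable over `ℚ`. One of the four
entries of `p` that distinguish the cases is nonzero, because otherwise `ω₁ ω₂ = 0`
(`exists_isCase`); call it `p s r`. The matrix of the algorithm expresses `v ∧ p = 0` with the
coordinates `s` and `r` of `v` as free variables (`kernel_equations`), and any two solutions `v`,
`w` have `v ∧ w` proportional to `p` (`plucker_mul_minor`).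

The Hermite normal form `(U ∣ V)` of `(Mᵀ ∣ 1)` has `V` unimodular and `U = V Mᵀ`. By the echelon
shape, row `i`, counted from `0`, starts with at least `i` zeros. Hence the last two rows of `U`
vanish, which means that the last two rows of `V` lie in the kernel of `M`, and the last row of
`V` starts with a zero. As `V` is unimodular, the minors of two of its rows generate the unit
ideal, so that `p` is an integral multiple of their bivector (`exists_eq_mul_minor`). The factor
is read off from the entry `(s, r)`.

Hermite normal forms exist for all integer matrices (`exists_isRowHermiteFormOf`).
-/

/-! ### Existence of the row-style Hermite normal form -/

/-- Some unimodular matrix takes a given integer vector `v` to a nonnegative multiple of the first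
basis vector.  For `v ≠ 0`, the factor `g` is the least positive integer that occurs as the first
entry of some `P *ᵥ v` with `P` unimodular. -/
theorem exists_unimodular_mulVec_eq_single {m : ℕ} (v : Fin (m + 1) → ℤ) :
    ∃ P : Matrix (Fin (m + 1)) (Fin (m + 1)) ℤ, IsUnit P.det ∧
      ∃ g : ℤ, 0 ≤ g ∧ P.mulVec v = Pi.single 0 g := by
  classical
  by_cases hv : v = 0
  · exact ⟨1, by simp, 0, le_rfl, by simp [hv]⟩
  let Q : ℕ → Prop := fun g => 0 < g ∧ ∃ P : Matrix (Fin (m + 1)) (Fin (m + 1)) ℤ,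
    IsUnit P.det ∧ P.mulVec v 0 = g
  -- Any nonzero entry can be moved to the first place and made positive.
  have key : ∀ (P : Matrix (Fin (m + 1)) (Fin (m + 1)) ℤ) (i : Fin (m + 1)), IsUnit P.det →
      P.mulVec v i ≠ 0 → Q (P.mulVec v i).natAbs := by
    intro P i hP hi
    refine ⟨Int.natAbs_pos.2 hi, ?_⟩
    have hσ : IsUnit ((Equiv.swap 0 i).permMatrix ℤ * P).det := by
      rw [Matrix.det_mul, Matrix.det_permutation]
      exact (Units.isUnit _).mul hP
    have hσv : ((Equiv.swap 0 i).permMatrix ℤ * P).mulVec v 0 = P.mulVec v i := by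
      rw [← Matrix.mulVec_mulVec, Matrix.permMatrix_mulVec]
      simp
    rcases Int.natAbs_eq (P.mulVec v i) with h | h
    · exact ⟨_, hσ, hσv.trans h⟩
    · refine ⟨-((Equiv.swap 0 i).permMatrix ℤ * P), ?_, ?_⟩
      · rw [Matrix.det_neg]
        exact ((isUnit_one.neg).pow _).mul hσ
      · rw [Matrix.neg_mulVec, Pi.neg_apply, hσv]
        omega
  have hQ : ∃ g, Q g := by
    obtain ⟨i, hi⟩ := Function.ne_iff.1 hv
    exact ⟨_, key 1 i (by simp) (by simpa using hi)⟩
  obtain ⟨hpos, P, hP, hPv⟩ := Nat.find_spec hQ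
  set g := Nat.find hQ with hg
  have hdvd : ∀ i, i ≠ 0 → (g : ℤ) ∣ P.mulVec v i := by
    intro i hi
    by_contra hnd
    -- The remainder of the `i`-th entry modulo `g` would be a smaller positive value.
    have hT : (Matrix.transvection i 0 (-(P.mulVec v i / g)) * P).mulVec v i
        = P.mulVec v i % g := by
      rw [← Matrix.mulVec_mulVec, Matrix.transvection, Matrix.add_mulVec, Matrix.single_mulVec]
      simp only [Matrix.one_mulVec, Pi.add_apply, Function.update_self, hPv]
      rw [Int.emod_def]
      ring
    have hne : P.mulVec v i % g ≠ 0 := fun h => hnd (Int.dvd_of_emod_eq_zero h)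
    have hq := key (Matrix.transvection i 0 (-(P.mulVec v i / g)) * P) i
      (by rw [Matrix.det_mul, Matrix.det_transvection_of_ne _ _ hi, one_mul]; exact hP)
      (by rwa [hT])
    rw [hT] at hq
    have h1 := Nat.find_min' hQ hq
    rw [← hg] at h1
    have h2 := Int.emod_lt_of_pos (P.mulVec v i) (by exact_mod_cast hpos : (0 : ℤ) < g)
    have h3 := Int.emod_nonneg (P.mulVec v i) (by exact_mod_cast hpos.ne' : (g : ℤ) ≠ 0)
    omega
  -- Clear all entries below the first one at once.
  let u : Fin (m + 1) → ℤ := fun i => if i = 0 then 0 else -(P.mulVec v i / g)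
  let e : Fin (m + 1) → ℤ := Pi.single 0 1
  refine ⟨(1 + Matrix.replicateCol Unit u * Matrix.replicateRow Unit e) * P, ?_,
    g, by positivity, ?_⟩
  · rw [Matrix.det_mul, Matrix.det_one_add_replicateCol_mul_replicateRow]
    simpa [u, e] using hP
  · rw [← Matrix.mulVec_mulVec, Matrix.add_mulVec, Matrix.one_mulVec, ← Matrix.mulVec_mulVec]
    ext i
    have hrow : (Matrix.replicateRow Unit e).mulVec
        (P.mulVec v) = fun _ => (g : ℤ) := by
      ext
      simp [Matrix.mulVec, dotProduct, Matrix.replicateRow_apply, Pi.single_apply, e] at hPv ⊢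
      exact hPv
    rw [Pi.add_apply, hrow]
    by_cases hi : i = 0
    · subst hi
      simp [Matrix.mulVec, dotProduct, u] at hPv ⊢
      exact hPv
    · have h := Int.ediv_mul_cancel (hdvd i hi)
      have h2 : (Matrix.replicateCol Unit u).mulVec (fun _ => (g : ℤ)) i
          = -(P.mulVec v i / g) * g := by
        simp only [Matrix.mulVec, dotProduct, Matrix.replicateCol_apply, u, if_neg hi]
        simp
      rw [h2, Pi.single_eq_of_ne hi]
      linarith

theorem IsLeadingEntry.eq {m n : ℕ} {H : Matrix (Fin m) (Fin n) ℤ} {i : Fin m} {j j' : Fin n}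
    (h : IsLeadingEntry H i j) (h' : IsLeadingEntry H i j') : j = j' := by
  rcases lt_trichotomy j j' with hlt | heq | hgt
  · exact absurd (h'.2 j hlt) h.1
  · exact heq
  · exact absurd (h.2 j' hgt) h'.1

theorem exists_isLeadingEntry {m n : ℕ} {H : Matrix (Fin m) (Fin n) ℤ} {i : Fin m}
    (h : H i ≠ 0) : ∃ j, IsLeadingEntry H i j := by
  classical
  obtain ⟨j, hj⟩ := Function.ne_iff.1 h
  obtain ⟨k, hk, hmin⟩ := WellFounded.has_min (wellFounded_lt (α := Fin n))
    {j | H i j ≠ 0} ⟨j, hj⟩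
  exact ⟨k, hk, fun j' hj' => by_contra fun hne => hmin j' hne hj'⟩

/-- A row whose first entry vanishes has its leading entry where the rest of the row has it. -/
theorem isLeadingEntry_iff_of_apply_zero {m m' n : ℕ} {H : Matrix (Fin m) (Fin (n + 1)) ℤ}
    {f : Fin m' → Fin m} {i : Fin m'} (h0 : H (f i) 0 = 0) {j : Fin (n + 1)} :
    IsLeadingEntry H (f i) j ↔
      ∃ j', j = Fin.succ j' ∧ IsLeadingEntry (H.submatrix f Fin.succ) i j' := by
  constructor
  · rintro ⟨hne, hlt⟩
    obtain ⟨j', rfl⟩ := Fin.exists_succ_eq.2 (fun h : j = 0 => hne (h ▸ h0))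
    exact ⟨j', rfl, hne, fun k hk => hlt _ (Fin.succ_lt_succ_iff.2 hk)⟩
  · rintro ⟨j', rfl, hne, hlt⟩
    refine ⟨hne, fun k hk => ?_⟩
    rcases Fin.eq_zero_or_eq_succ k with rfl | ⟨k, rfl⟩
    · exact h0
    · exact hlt k (Fin.succ_lt_succ_iff.1 hk)

theorem IsRowHermite.of_zero_col {m n : ℕ} {H : Matrix (Fin m) (Fin (n + 1)) ℤ}
    (hB : IsRowHermite (H.submatrix id Fin.succ)) (h0 : ∀ i, H i 0 = 0) : IsRowHermite H := by
  have hl : ∀ {i j}, IsLeadingEntry H i j ↔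
      ∃ j', j = Fin.succ j' ∧ IsLeadingEntry (H.submatrix id Fin.succ) i j' :=
    fun {i j} => isLeadingEntry_iff_of_apply_zero (f := id) (h0 i)
  refine ⟨fun i i' j' hii' hj' => ?_, fun i j hj => ?_, fun i j hj i' hi' => ?_⟩
  · obtain ⟨k', rfl, hk'⟩ := hl.1 hj'
    obtain ⟨k, hkk', hk⟩ := hB.echelon i i' k' hii' hk'
    exact ⟨k.succ, Fin.succ_lt_succ_iff.2 hkk', hl.2 ⟨k, rfl, hk⟩⟩
  · obtain ⟨k, rfl, hk⟩ := hl.1 hj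
    exact hB.pos i k hk
  · obtain ⟨k, rfl, hk⟩ := hl.1 hj
    exact hB.reduced i k hk i' hi'

theorem IsRowHermite.of_corner {m n : ℕ} {H : Matrix (Fin (m + 1)) (Fin (n + 1)) ℤ}
    (hB : IsRowHermite (H.submatrix Fin.succ Fin.succ)) (h0 : ∀ i, H (Fin.succ i) 0 = 0)
    (hpos : 0 < H 0 0)
    (hred : ∀ i j, IsLeadingEntry (H.submatrix Fin.succ Fin.succ) i j →
      0 ≤ H 0 j.succ ∧ H 0 j.succ < H i.succ j.succ) : IsRowHermite H := by
  have hl : ∀ {i : Fin m} {j}, IsLeadingEntry H i.succ j ↔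
      ∃ j', j = Fin.succ j' ∧ IsLeadingEntry (H.submatrix Fin.succ Fin.succ) i j' :=
    fun {i j} => isLeadingEntry_iff_of_apply_zero (f := Fin.succ) (h0 i)
  have hl0 : IsLeadingEntry H 0 0 := ⟨hpos.ne', fun j hj => absurd hj (Fin.not_lt_zero j)⟩
  refine ⟨fun i i' j' hii' hj' => ?_, fun i j hj => ?_, fun i j hj i' hi' => ?_⟩
  · obtain ⟨i', rfl⟩ := Fin.exists_succ_eq.2 (Fin.ne_zero_of_lt hii')
    obtain ⟨k', rfl, hk'⟩ := hl.1 hj'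
    rcases Fin.eq_zero_or_eq_succ i with rfl | ⟨i, rfl⟩
    · exact ⟨0, Fin.succ_pos k', hl0⟩
    · obtain ⟨k, hkk', hk⟩ := hB.echelon i i' k' (Fin.succ_lt_succ_iff.1 hii') hk'
      exact ⟨k.succ, Fin.succ_lt_succ_iff.2 hkk', hl.2 ⟨k, rfl, hk⟩⟩
  · rcases Fin.eq_zero_or_eq_succ i with rfl | ⟨i, rfl⟩
    · exact hj.eq hl0 ▸ hpos
    · obtain ⟨k, rfl, hk⟩ := hl.1 hj
      exact hB.pos i k hk
  · obtain ⟨i, rfl⟩ := Fin.exists_succ_eq.2 (Fin.ne_zero_of_lt hi')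
    obtain ⟨k, rfl, hk⟩ := hl.1 hj
    rcases Fin.eq_zero_or_eq_succ i' with rfl | ⟨i', rfl⟩
    · exact hred i k hk
    · exact hB.reduced i k hk i' (Fin.succ_lt_succ_iff.1 hi')

/-- A vector can be reduced modulo the rows of a Hermite normal form.  The rows are used from top
to bottom: a row vanishes at the leading positions of the rows above it, so it does not disturb
what has been reduced before. -/
theorem IsRowHermite.exists_add_vecMul_reduced {m n : ℕ} {H : Matrix (Fin m) (Fin n) ℤ}
    (hH : IsRowHermite H) (r : Fin n → ℤ) :
    ∃ x : Fin m → ℤ, ∀ i j, IsLeadingEntry H i j →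
      0 ≤ (r + Matrix.vecMul x H) j ∧ (r + Matrix.vecMul x H) j < H i j := by
  classical
  suffices h : ∀ k : ℕ, ∃ x : Fin m → ℤ, ∀ i j, i.val < k → IsLeadingEntry H i j →
      0 ≤ (r + Matrix.vecMul x H) j ∧ (r + Matrix.vecMul x H) j < H i j by
    obtain ⟨x, hx⟩ := h m
    exact ⟨x, fun i j => hx i j i.isLt⟩
  intro k
  induction k with
  | zero => exact ⟨0, fun i j hi => absurd hi (Nat.not_lt_zero _)⟩
  | succ k ih =>
    obtain ⟨x, hx⟩ := ih
    by_cases hk : ∃ i₀ : Fin m, i₀.val = k ∧ ∃ j, IsLeadingEntry H i₀ j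
    · obtain ⟨i₀, hi₀, j₀, hj₀⟩ := hk
      refine ⟨x - Pi.single i₀ ((r + Matrix.vecMul x H) j₀ / H i₀ j₀), fun i j hi hj => ?_⟩
      have hv : ∀ j, (r + Matrix.vecMul
            (x - Pi.single i₀ ((r + Matrix.vecMul x H) j₀ / H i₀ j₀)) H) j
          = (r + Matrix.vecMul x H) j - (r + Matrix.vecMul x H) j₀ / H i₀ j₀ * H i₀ j := by
        intro j
        rw [Matrix.sub_vecMul, Matrix.single_vecMul]
        simp only [Pi.add_apply, Pi.sub_apply, Pi.smul_apply, Matrix.row_apply, smul_eq_mul]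
        ring
      rw [hv]
      rcases Nat.lt_succ_iff_lt_or_eq.1 hi with hi | hi
      · obtain ⟨j', hj', hl⟩ := hH.echelon i i₀ j₀ (by rw [Fin.lt_def]; omega) hj₀
        rw [hj₀.2 j (hj.eq hl ▸ hj'), mul_zero, sub_zero]
        exact hx i j hi hj
      · obtain rfl : i = i₀ := Fin.ext (hi.trans hi₀.symm)
        obtain rfl := hj.eq hj₀
        have hp := hH.pos i j hj
        rw [mul_comm, ← Int.emod_def]
        exact ⟨Int.emod_nonneg _ hp.ne', Int.emod_lt_of_pos _ hp⟩
    · refine ⟨x, fun i j hi hj => hx i j ?_ hj⟩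
      rcases Nat.lt_succ_iff_lt_or_eq.1 hi with hi | hi
      · exact hi
      · exact absurd ⟨i, hi, j, hj⟩ hk

/-- Every integer matrix has a row-style Hermite normal form.  Induction on the number of columns:
clear the first column below its first entry, treat the block that remains, and reduce the first
row if it has a pivot. -/
theorem exists_isRowHermiteFormOf {m n : ℕ} (A : Matrix (Fin m) (Fin n) ℤ) :
    ∃ H, IsRowHermiteFormOf H A := by
  induction n generalizing m with
  | zero => exact ⟨A, ⟨fun _ _ j => j.elim0, fun _ j => j.elim0, fun _ j => j.elim0⟩, 1, by simp⟩
  | succ n ih =>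
    obtain _ | m := m
    · exact ⟨A, ⟨fun i => i.elim0, fun i => i.elim0, fun i => i.elim0⟩, 1, by simp⟩
    obtain ⟨P, hP, g, hg, hPA⟩ := exists_unimodular_mulVec_eq_single (fun i => A i 0)
    have hcol : ∀ i, (P * A) i 0 = (Pi.single 0 g : Fin (m + 1) → ℤ) i := fun i => by
      rw [← hPA]; rfl
    generalize hA' : P * A = A' at hcol
    have hcol0 : A' 0 0 = g := by simp [hcol]
    have hcolS : ∀ i : Fin m, A' i.succ 0 = 0 := fun i => by simp [hcol]
    rcases hg.eq_or_lt with rfl | hg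
    · obtain ⟨_, hB, Q, hQ, rfl⟩ := ih (A'.submatrix id Fin.succ)
      refine ⟨Q * A', IsRowHermite.of_zero_col hB fun i => ?_, Q * P, ?_, ?_⟩
      · simp [Matrix.mul_apply, hcol]
      · rw [Matrix.det_mul]
        exact hQ.mul hP
      · rw [← hA', Matrix.mul_assoc]
    · obtain ⟨_, hB, Q, hQ, rfl⟩ := ih (A'.submatrix Fin.succ Fin.succ)
      obtain ⟨x, hx⟩ := hB.exists_add_vecMul_reduced (fun j => A' 0 j.succ)
      let R : Matrix (Fin (m + 1)) (Fin (m + 1)) ℤ :=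
        Matrix.of (Fin.cons (Fin.cons 1 (Matrix.vecMul x Q)) fun i => Fin.cons 0 (Q i))
      have hR00 : R 0 0 = 1 := rfl
      have hR0S : ∀ k : Fin m, R 0 k.succ = Matrix.vecMul x Q k := fun k => rfl
      have hRS0 : ∀ i : Fin m, R i.succ 0 = 0 := fun i => rfl
      have hRSS : ∀ i k : Fin m, R i.succ k.succ = Q i k := fun i k => rfl
      have hR : R.det = Q.det := by
        rw [Matrix.det_succ_column_zero, Fin.sum_univ_succ]
        have : R.submatrix Fin.succ Fin.succ = Q := by
          ext i k; exact hRSS i k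
        simp [hR00, hRS0, this]
      have hSS : (R * A').submatrix Fin.succ Fin.succ = Q * A'.submatrix Fin.succ Fin.succ := by
        ext i j
        simp [Matrix.mul_apply, Fin.sum_univ_succ, hRS0, hRSS]
      have h0S : ∀ j : Fin n, (R * A') 0 j.succ = ((fun j : Fin n => A' 0 j.succ)
          + Matrix.vecMul x (Q * A'.submatrix Fin.succ Fin.succ)) j := by
        intro j
        rw [← Matrix.vecMul_vecMul, Matrix.mul_apply, Fin.sum_univ_succ, hR00, one_mul]
        simp only [hR0S]
        rfl
      refine ⟨R * A', IsRowHermite.of_corner ?_ ?_ ?_ ?_, R * P, ?_, ?_⟩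
      · rw [hSS]
        exact hB
      · intro i
        simp [Matrix.mul_apply, Fin.sum_univ_succ, hRS0, hcolS]
      · simp [Matrix.mul_apply, Fin.sum_univ_succ, hR00, hcol0, hcolS, hg]
      · intro i j hij
        rw [hSS] at hij
        rw [h0S, show (R * A') i.succ j.succ = (Q * A'.submatrix Fin.succ Fin.succ) i j from
          congrFun (congrFun hSS i) j]
        exact hx i j hij
      · rw [Matrix.det_mul, hR]
        exact hQ.mul hP
      · rw [← hA', Matrix.mul_assoc]

/-! ### The rows of the transformation matrix -/

/-- In echelon form the leading entry of row `i` lies in column `i` or further right. -/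
theorem IsRowHermite.le_of_isLeadingEntry {m n : ℕ} {H : Matrix (Fin m) (Fin n) ℤ}
    (hH : IsRowHermite H) {i : Fin m} {j : Fin n} (h : IsLeadingEntry H i j) :
    i.val ≤ j.val := by
  obtain ⟨i, hi⟩ := i
  induction i generalizing j with
  | zero => exact Nat.zero_le _
  | succ i ih =>
    obtain ⟨j', hj', hl⟩ := hH.echelon ⟨i, by omega⟩ ⟨i + 1, hi⟩ j (by simp) h
    have := ih (by omega) hl
    rw [Fin.lt_def] at hj'
    simp only at this ⊢
    omega

theorem IsRowHermite.apply_eq_zero_of_lt {m n : ℕ} {H : Matrix (Fin m) (Fin n) ℤ}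
    (hH : IsRowHermite H) {i : Fin m} {j : Fin n} (h : j.val < i.val) : H i j = 0 := by
  by_cases h0 : H i = 0
  · rw [h0]; rfl
  · obtain ⟨k, hk⟩ := exists_isLeadingEntry h0
    have := hH.le_of_isLeadingEntry hk
    exact hk.2 j (by rw [Fin.lt_def]; omega)

theorem beside_castAdd {m p q : ℕ} (U : Matrix (Fin m) (Fin p) ℤ) (V : Matrix (Fin m) (Fin q) ℤ)
    (i : Fin m) (j : Fin p) : beside U V i (Fin.castAdd q j) = U i j := by
  simp [beside]

theorem beside_natAdd {m p q : ℕ} (U : Matrix (Fin m) (Fin p) ℤ) (V : Matrix (Fin m) (Fin q) ℤ)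
    (i : Fin m) (j : Fin q) : beside U V i (Fin.natAdd p j) = V i j := by
  simp [beside]

theorem exists_eq_beside {m p q : ℕ} (H : Matrix (Fin m) (Fin (p + q)) ℤ) :
    ∃ U V, H = beside U V := by
  refine ⟨H.submatrix id (Fin.castAdd q), H.submatrix id (Fin.natAdd p), ?_⟩
  ext i j
  induction j using Fin.addCases with
  | left j => rw [beside_castAdd]; rfl
  | right j => rw [beside_natAdd]; rfl

/-- The right-hand block of the Hermite normal form of `(N ∣ 1)` is the transforming matrix. -/
theorem IsRowHermiteFormOf.beside_one {m p : ℕ} {U N : Matrix (Fin m) (Fin p) ℤ}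
    {V : Matrix (Fin m) (Fin m) ℤ} (h : IsRowHermiteFormOf (beside U V) (beside N 1)) :
    IsUnit V.det ∧ U = V * N := by
  obtain ⟨-, P, hP, hUV⟩ := h
  have hV : V = P := by
    ext i j
    have h1 := congrFun (congrFun hUV i) (Fin.natAdd p j)
    rw [beside_natAdd, Matrix.mul_apply] at h1
    simp only [beside_natAdd] at h1
    rw [h1, ← Matrix.mul_apply, Matrix.mul_one]
  subst hV
  refine ⟨hP, ?_⟩
  ext i j
  have h1 := congrFun (congrFun hUV i) (Fin.castAdd m j)
  rw [beside_castAdd, Matrix.mul_apply] at h1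
  simp only [beside_castAdd] at h1
  rw [h1, ← Matrix.mul_apply]

/-- The rows of `V` of index at least `p` lie in the kernel of the `p`-rowed matrix `M`. -/
theorem IsRowHermiteFormOf.mulVec_row_eq_zero {m p : ℕ} {M : Matrix (Fin p) (Fin m) ℤ}
    {U : Matrix (Fin m) (Fin p) ℤ} {V : Matrix (Fin m) (Fin m) ℤ}
    (h : IsRowHermiteFormOf (beside U V) (beside M.transpose 1)) {i : Fin m} (hi : p ≤ i.val) :
    M.mulVec (V i) = 0 := by
  ext j
  have h1 : U i j = 0 := by
    rw [← beside_castAdd U V]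
    exact h.1.apply_eq_zero_of_lt (by simp; omega)
  rw [h.beside_one.2, Matrix.mul_apply] at h1
  simpa [Matrix.mulVec, dotProduct, mul_comm] using h1

/-! ### Decomposable bivectors -/

/-- Let `p` be a bivector with `p s r ≠ 0` which satisfies the Plücker relations involving `p s r`,
and let `v`, `w` be annihilated by `p`, that is `v ∧ p = w ∧ p = 0`.  Then `v ∧ w` is
proportional to `p`. -/
theorem plucker_mul_minor {ι R : Type*} [CommRing R] [IsDomain R] {p : ι → ι → R} {s r : ι}
    (hsr : p s r ≠ 0) (hp : ∀ i j, p i j * p s r = p i s * p j r - p i r * p j s) {v w : ι → R}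
    (hv : ∀ i, p s r * v i = v s * p i r - v r * p i s)
    (hw : ∀ i, p s r * w i = w s * p i r - w r * p i s) (i j : ι) :
    p i j * (v s * w r - v r * w s) = p s r * (v i * w j - v j * w i) := by
  apply mul_left_cancel₀ hsr
  linear_combination (v s * w r - v r * w s) * hp i j - p s r * w j * hv i
    - (v s * p i r - v r * p i s) * hw j + p s r * w i * hv j + (v s * p j r - v r * p j s) * hw i

/-- The `2 × 2` minors of two rows of a unimodular matrix generate the unit ideal, so that a
bivector over `R` which is proportional to the bivector of these minors is a multiple of it by an
element of `R`. -/
theorem exists_eq_mul_minor {n R : Type*} [Fintype n] [DecidableEq n] [CommRing R] [IsDomain R]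
    {V : Matrix n n R} (hV : IsUnit V.det) {a b : n} (hab : a ≠ b) {p : n → n → R} {s r : n}
    (hsr : p s r ≠ 0)
    (hp : ∀ i j, p i j * (V a s * V b r - V a r * V b s)
      = p s r * (V a i * V b j - V a j * V b i)) :
    V a s * V b r - V a r * V b s ≠ 0 ∧ ∃ k : R, k * (V a s * V b r - V a r * V b s) = p s r ∧
      ∀ i j, p i j = k * (V a i * V b j - V a j * V b i) := by
  set D := V a s * V b r - V a r * V b s
  set W := V⁻¹
  have hW : ∀ x y, ∑ i, V x i * W i y = (1 : Matrix n n R) x y := fun x y => by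
    rw [← Matrix.mul_apply, Matrix.mul_nonsing_inv V hV]
  -- Cauchy–Binet for the two rows of `V` and the two columns of its inverse.
  have hone : ∑ i, ∑ j, (V a i * V b j - V a j * V b i) * (W i a * W j b) = 1 := by
    calc _ = (∑ i, V a i * W i a) * (∑ j, V b j * W j b)
          - (∑ i, V b i * W i a) * (∑ j, V a j * W j b) := by
          rw [Finset.sum_mul_sum, Finset.sum_mul_sum, ← Finset.sum_sub_distrib]
          refine Finset.sum_congr rfl fun i _ => ?_
          rw [← Finset.sum_sub_distrib]
          exact Finset.sum_congr rfl fun j _ => by ring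
      _ = 1 := by simp [hW, hab]
  have hk : (∑ i, ∑ j, p i j * (W i a * W j b)) * D = p s r := by
    rw [← mul_one (p s r), ← hone, Finset.sum_mul, Finset.mul_sum]
    refine Finset.sum_congr rfl fun i _ => ?_
    rw [Finset.sum_mul, Finset.mul_sum]
    refine Finset.sum_congr rfl fun j _ => ?_
    linear_combination (W i a * W j b) * hp i j
  have hD0 : D ≠ 0 := fun h => hsr (by rw [← hk, h, mul_zero])
  refine ⟨hD0, _, hk, fun i j => mul_right_cancel₀ hD0 ?_⟩
  rw [hp, ← hk]
  ring

/-! ### Multiplication tables of normalized bases -/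

/-- The identities satisfied by the coefficients `c i j k` of the multiplication table of a
normalized basis `1, ω₁, ω₂, ω₃` of a commutative ring. -/
structure IsNormalizedTable (c : Fin 4 → Fin 4 → Fin 4 → ℤ) : Prop where
  assoc : ∀ i j k l, ∑ q, c i j q * c q k l = ∑ q, c j k q * c i q l
  comm : ∀ i j, c i j = c j i
  one_left : ∀ i, c 0 i = Pi.single i 1
  c12_1 : c 1 2 1 = 0
  c12_2 : c 1 2 2 = 0
  c13_1 : c 1 3 1 = 0

theorem mulCoeff_sum_smul {R : Type*} [CommRing R] (ω : Module.Basis (Fin 4) ℤ R)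
    (i j : Fin 4) : ∑ q, mulCoeff ω i j q • ω q = ω i * ω j :=
  ω.sum_repr (ω i * ω j)

theorem mulCoeff_assoc {R : Type*} [CommRing R] (ω : Module.Basis (Fin 4) ℤ R)
    (i j k l : Fin 4) : ∑ q, mulCoeff ω i j q * mulCoeff ω q k l
      = ∑ q, mulCoeff ω j k q * mulCoeff ω i q l := by
  have h1 : ω.repr (ω i * ω j * ω k) l = ∑ q, mulCoeff ω i j q * mulCoeff ω q k l := by
    rw [← mulCoeff_sum_smul ω i j, Finset.sum_mul, map_sum, Finset.sum_apply']
    refine Finset.sum_congr rfl fun q _ => ?_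
    rw [smul_mul_assoc, map_smul, Finsupp.smul_apply, smul_eq_mul]
    rfl
  have h2 : ω.repr (ω i * (ω j * ω k)) l = ∑ q, mulCoeff ω j k q * mulCoeff ω i q l := by
    rw [← mulCoeff_sum_smul ω j k, Finset.mul_sum, map_sum, Finset.sum_apply']
    refine Finset.sum_congr rfl fun q _ => ?_
    rw [mul_smul_comm, map_smul, Finsupp.smul_apply, smul_eq_mul]
    rfl
  rw [← h1, ← h2, mul_assoc]

theorem IsNormalizedBasis.isNormalizedTable {R : Type*} [CommRing R]
    {ω : Module.Basis (Fin 4) ℤ R} (hω : IsNormalizedBasis ω) :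
    IsNormalizedTable (mulCoeff ω) where
  assoc := mulCoeff_assoc ω
  comm i j := by
    unfold mulCoeff
    rw [mul_comm]
  one_left i := by
    ext k
    simp [mulCoeff, hω.1, Finsupp.single_apply, Pi.single_apply, eq_comm]
  c12_1 := hω.2.1
  c12_2 := hω.2.2.1
  c13_1 := hω.2.2.2

/-- The bivector attached to a normalized multiplication table.  If the table comes from a pair of
forms `(a, b)`, the entry `(i, j)` is `aᵢ bⱼ - aⱼ bᵢ`, where `0, …, 5` number the coefficients of
`x², xy, xz, y², yz, z²` in this order. -/
def tableBivector (c : Fin 4 → Fin 4 → Fin 4 → ℤ) : Fin 6 → Fin 6 → ℤ :=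
  !![0, -c 1 1 3, c 1 1 2, -c 1 2 3, -c 1 3 3, c 1 3 2;
     c 1 1 3, 0, c 1 3 3 - c 1 1 1, -c 2 2 3, c 2 2 2 - c 2 3 3, c 2 3 2;
     -c 1 1 2, -(c 1 3 3 - c 1 1 1), 0, -c 2 3 3, -(c 3 3 3 - c 2 3 2), c 3 3 2;
     c 1 2 3, c 2 2 3, c 2 3 3, 0, -c 2 2 1, -c 2 3 1;
     c 1 3 3, -(c 2 2 2 - c 2 3 3), c 3 3 3 - c 2 3 2, c 2 2 1, 0, -c 3 3 1;
     -c 1 3 2, -c 2 3 2, -c 3 3 2, c 2 3 1, c 3 3 1, 0]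

namespace IsNormalizedTable

variable {c : Fin 4 → Fin 4 → Fin 4 → ℤ}

theorem one_right (h : IsNormalizedTable c) (i : Fin 4) : c i 0 = Pi.single i 1 :=
  (h.comm i 0).trans (h.one_left i)

/-- The constant coefficients are forced by associativity. -/
theorem constant_coeffs (h : IsNormalizedTable c) :
    c 1 1 0 = c 1 2 3 * c 1 3 2 - c 1 1 2 * c 2 2 2 - c 1 1 3 * c 2 3 2 ∧
    c 1 2 0 = c 1 1 2 * c 2 2 1 + c 1 1 3 * c 2 3 1 ∧
    c 1 3 0 = c 1 1 2 * c 2 3 1 + c 1 1 3 * c 3 3 1 ∧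
    c 2 2 0 = c 1 2 3 * c 2 3 1 - c 1 1 1 * c 2 2 1 ∧
    c 2 3 0 = c 1 2 3 * c 3 3 1 - c 1 1 1 * c 2 3 1 ∧
    c 3 3 0 = (c 1 3 3 - c 1 1 1) * c 3 3 1 + c 1 3 2 * c 2 3 1 := by
  have a1122 := h.assoc 1 1 2 2
  have a1121 := h.assoc 1 1 2 1
  have a1131 := h.assoc 1 1 3 1
  have a1221 := h.assoc 1 2 2 1
  have a1231 := h.assoc 1 2 3 1
  have a1331 := h.assoc 1 3 3 1
  simp [Fin.sum_univ_four, h.one_left, h.one_right, h.comm 3 2,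
    h.c12_1, h.c12_2, h.c13_1] at a1122 a1121 a1131 a1221 a1231 a1331
  refine ⟨?_, ?_, ?_, ?_, ?_, ?_⟩
  · linear_combination a1122
  · linear_combination -a1121
  · linear_combination -a1131
  · linear_combination -a1221
  · linear_combination -a1231
  · linear_combination -a1331

/-- The three-term Plücker relations; each of them is, up to sign, a coefficient of an associator or
a sum or difference of two such coefficients. -/
theorem plucker_relations (h : IsNormalizedTable c) :
    let p := tableBivector c
    p 0 1 * p 2 3 - p 0 2 * p 1 3 + p 0 3 * p 1 2 = 0 ∧
    p 0 1 * p 2 4 - p 0 2 * p 1 4 + p 0 4 * p 1 2 = 0 ∧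
    p 0 1 * p 2 5 - p 0 2 * p 1 5 + p 0 5 * p 1 2 = 0 ∧
    p 0 1 * p 3 4 - p 0 3 * p 1 4 + p 0 4 * p 1 3 = 0 ∧
    p 0 1 * p 3 5 - p 0 3 * p 1 5 + p 0 5 * p 1 3 = 0 ∧
    p 0 1 * p 4 5 - p 0 4 * p 1 5 + p 0 5 * p 1 4 = 0 ∧
    p 0 2 * p 3 4 - p 0 3 * p 2 4 + p 0 4 * p 2 3 = 0 ∧
    p 0 2 * p 3 5 - p 0 3 * p 2 5 + p 0 5 * p 2 3 = 0 ∧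
    p 0 2 * p 4 5 - p 0 4 * p 2 5 + p 0 5 * p 2 4 = 0 ∧
    p 0 3 * p 4 5 - p 0 4 * p 3 5 + p 0 5 * p 3 4 = 0 ∧
    p 1 2 * p 3 4 - p 1 3 * p 2 4 + p 1 4 * p 2 3 = 0 ∧
    p 1 2 * p 3 5 - p 1 3 * p 2 5 + p 1 5 * p 2 3 = 0 ∧
    p 1 2 * p 4 5 - p 1 4 * p 2 5 + p 1 5 * p 2 4 = 0 ∧
    p 1 3 * p 4 5 - p 1 4 * p 3 5 + p 1 5 * p 3 4 = 0 ∧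
    p 2 3 * p 4 5 - p 2 4 * p 3 5 + p 2 5 * p 3 4 = 0 := by
  have a1121 := h.assoc 1 1 2 1
  have a1122 := h.assoc 1 1 2 2
  have a1123 := h.assoc 1 1 2 3
  have a1131 := h.assoc 1 1 3 1
  have a1132 := h.assoc 1 1 3 2
  have a1133 := h.assoc 1 1 3 3
  have a1221 := h.assoc 1 2 2 1
  have a1223 := h.assoc 1 2 2 3
  have a1232 := h.assoc 1 2 3 2
  have a1233 := h.assoc 1 2 3 3
  have a1321 := h.assoc 1 3 2 1
  have a1322 := h.assoc 1 3 2 2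
  have a1323 := h.assoc 1 3 2 3
  have a1331 := h.assoc 1 3 3 1
  have a1332 := h.assoc 1 3 3 2
  have a2131 := h.assoc 2 1 3 1
  have a2231 := h.assoc 2 2 3 1
  have a2232 := h.assoc 2 2 3 2
  have a2233 := h.assoc 2 2 3 3
  have a2331 := h.assoc 2 3 3 1
  have a2332 := h.assoc 2 3 3 2
  simp [Fin.sum_univ_four, h.one_left, h.one_right, h.comm 2 1, h.comm 3 2,
    h.c12_1, h.c12_2, h.c13_1]
    at a1121 a1122 a1123 a1131 a1132 a1133 a1221 a1223 a1232 a1233 a1321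
      a1322 a1323 a1331 a1332 a2131 a2231 a2232 a2233 a2331 a2332
  intro p
  simp only [p, tableBivector, Matrix.of_apply, Matrix.cons_val]
  refine ⟨?_, ?_, ?_, ?_, ?_, ?_, ?_, ?_, ?_, ?_, ?_, ?_, ?_, ?_, ?_⟩
  · linear_combination a1123
  · linear_combination a1133 - a1122
  · linear_combination -a1132
  · linear_combination -a1223
  · linear_combination -a1323
  · linear_combination a1131 + a1322
  · linear_combination -a1121 - a1233
  · linear_combination a1232
  · linear_combination a1332
  · linear_combination a2131
  · linear_combination -a1221 - a2233
  · linear_combination a2232 - a1321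
  · linear_combination a2332 - a1331
  · linear_combination a2231
  · linear_combination a2331

set_option maxHeartbeats 1000000 in
/-- The Plücker relations which involve the entry `(s, r)`, for the pairs `(s, r)` at which the
cases of the algorithm require a nonzero entry. -/
theorem tableBivector_mul (h : IsNormalizedTable c) {s r : Fin 6}
    (hsr : (s, r) = (1, 2) ∨ (s, r) = (0, 2) ∨ (s, r) = (0, 1) ∨ (s, r) = (0, 3)) (i j : Fin 6) :
    tableBivector c i j * tableBivector c s r = tableBivector c i s * tableBivector c j r
      - tableBivector c i r * tableBivector c j s := by
  have H := h.plucker_relations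
  simp only [tableBivector, Matrix.of_apply, Matrix.cons_val] at H
  obtain ⟨h1, h2, h3, h4, h5, h6, h7, h8, h9, h10, h11, h12, h13, -, -⟩ := H
  rcases hsr with h | h | h | h <;> obtain ⟨rfl, rfl⟩ := Prod.mk.inj h <;>
    fin_cases i <;> fin_cases j <;>
    simp only [tableBivector, Matrix.of_apply, Matrix.cons_val, Fin.mk_one, Fin.zero_eta,
      Fin.reduceFinMk, Fin.isValue] <;>
    linarith

end IsNormalizedTable

/-! ### Correctness of the algorithm -/

namespace QuarticAlgorithm

/-- The columns `(s, r)` which carry no pivot of `matrixM c t`. -/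
def freeColumns : CaseIndex → Fin 6 × Fin 6
  | .one => (1, 2)
  | .two => (0, 2)
  | .three => (0, 1)
  | .four => (0, 3)

theorem tableBivector_freeColumns (c : Fin 4 → Fin 4 → Fin 4 → ℤ) (t : CaseIndex) :
    tableBivector c (freeColumns t).1 (freeColumns t).2 = numK c t := by
  cases t <;> rfl

theorem numK_ne_zero {c : Fin 4 → Fin 4 → Fin 4 → ℤ} {t : CaseIndex} (ht : IsCase c t) :
    numK c t ≠ 0 := by
  cases t
  · exact ht
  · exact ht.2
  · exact neg_ne_zero.2 ht.2.2
  · exact neg_ne_zero.2 ht.2.2.2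

theorem denK_eq {V : Matrix (Fin 6) (Fin 6) ℤ} (hV : V 5 0 = 0) (t : CaseIndex) :
    denK V t = V 4 (freeColumns t).1 * V 5 (freeColumns t).2
      - V 4 (freeColumns t).2 * V 5 (freeColumns t).1 := by
  cases t <;> simp [denK, freeColumns, hV]

/-- The equations `matrixM c t *ᵥ v = 0` say that the trivector `v ∧ p` vanishes, where `p` is the
bivector of the table. -/
theorem kernel_equations {c : Fin 4 → Fin 4 → Fin 4 → ℤ} {t : CaseIndex} (ht : IsCase c t)
    {v : Fin 6 → ℤ} (hv : (matrixM c t).mulVec v = 0) (i : Fin 6) :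
    tableBivector c (freeColumns t).1 (freeColumns t).2 * v i
      = v (freeColumns t).1 * tableBivector c i (freeColumns t).2
        - v (freeColumns t).2 * tableBivector c i (freeColumns t).1 := by
  have h0 := congrFun hv 0
  have h1 := congrFun hv 1
  have h2 := congrFun hv 2
  have h3 := congrFun hv 3
  cases t <;>
    simp [matrixM, Matrix.mulVec, dotProduct, Fin.sum_univ_six, ell, emm, enn] at h0 h1 h2 h3 <;>
    simp only [IsCase, ell] at ht <;>
    fin_cases i <;>
    simp [tableBivector, freeColumns] <;>
    grind

theorem isCase_unique {c : Fin 4 → Fin 4 → Fin 4 → ℤ} {t t' : CaseIndex} (h : IsCase c t)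
    (h' : IsCase c t') : t = t' := by
  cases t <;> cases t' <;> simp_all [IsCase]

/-- If no case applied, then `ω₁ ω₂` would be the integer `c_{12}^{(0)}`, which associativity
expresses as a combination of `c_{11}^{(2)} = 0` and `c_{11}^{(3)} = 0`.  So `ω₁ ω₂ = 0`, which is
impossible in a domain. -/
theorem exists_isCase {R : Type*} [CommRing R] [IsDomain R] {ω : Module.Basis (Fin 4) ℤ R}
    (hω : IsNormalizedBasis ω) : ∃ t, IsCase (mulCoeff ω) t := by
  by_contra hno
  have h1 : ell (mulCoeff ω) = 0 := by_contra fun h => hno ⟨.one, h⟩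
  have h2 : mulCoeff ω 1 1 2 = 0 := by_contra fun h => hno ⟨.two, h1, h⟩
  have h3 : mulCoeff ω 1 1 3 = 0 := by_contra fun h => hno ⟨.three, h1, h2, h⟩
  have h4 : mulCoeff ω 1 2 3 = 0 := by_contra fun h => hno ⟨.four, h1, h2, h3, h⟩
  have h := hω.isNormalizedTable
  have h5 : mulCoeff ω 1 2 0 = 0 := by simp [h.constant_coeffs.2.1, h2, h3]
  have h12 : ω 1 * ω 2 = 0 := by
    rw [← mulCoeff_sum_smul]
    simp [Fin.sum_univ_four, h4, h5, h.c12_1, h.c12_2]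
  rcases mul_eq_zero.1 h12 with h0 | h0
  · exact ω.ne_zero 1 h0
  · exact ω.ne_zero 2 h0

/-- The bivector determines the table: its entries give the coefficients `c_{ij}^{(k)}` with
`k ≥ 1`, and associativity gives the constant ones. -/
theorem isTableOfPair {c : Fin 4 → Fin 4 → Fin 4 → ℤ} (h : IsNormalizedTable c)
    {V : Matrix (Fin 6) (Fin 6) ℤ} (hV : V 5 0 = 0) {k : ℤ}
    (hk : ∀ i j, tableBivector c i j = k * (V 4 i * V 5 j - V 4 j * V 5 i)) :
    IsTableOfPair (formA k V) (formB V) c := by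
  obtain ⟨k11, k12, k13, k22, k23, k33⟩ := h.constant_coeffs
  have k01 := hk 0 1
  have k02 := hk 0 2
  have k03 := hk 0 3
  have k04 := hk 0 4
  have k05 := hk 0 5
  have k_12 := hk 1 2
  have k_13 := hk 1 3
  have k14 := hk 1 4
  have k15 := hk 1 5
  have k_23 := hk 2 3
  have k24 := hk 2 4
  have k25 := hk 2 5
  have k34 := hk 3 4
  have k35 := hk 3 5
  have k45 := hk 4 5
  simp only [tableBivector, Matrix.of_apply, Matrix.cons_val, hV]
    at k01 k02 k03 k04 k05
      k_12 k_13 k14 k15 k_23 k24 k25 k34 k35 k45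
  have h1 := h.c12_1
  have h2 := h.c12_2
  have h3 := h.c13_1
  constructor <;> simp only [formA, formB, h1, h2, h3] <;> linarith

end QuarticAlgorithm

open QuarticAlgorithm in
theorem mainTheorem2 {K : Type*} [Field K] [NumberField K] (hK : Module.finrank ℚ K = 4)
    (O : Subring K) (hO : IsOrderIn O) (ω : Module.Basis (Fin 4) ℤ O)
    (hω : IsNormalizedBasis ω) :
    (∃! t, QuarticAlgorithm.IsCase (mulCoeff ω) t) ∧
    ∀ t, QuarticAlgorithm.IsCase (mulCoeff ω) t →
      (∃ (U : Matrix (Fin 6) (Fin 4) ℤ) (V : Matrix (Fin 6) (Fin 6) ℤ),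
        IsRowHermiteFormOf (beside U V)
          (beside (QuarticAlgorithm.matrixM (mulCoeff ω) t).transpose 1)) ∧
      ∀ (U : Matrix (Fin 6) (Fin 4) ℤ) (V : Matrix (Fin 6) (Fin 6) ℤ),
        IsRowHermiteFormOf (beside U V)
          (beside (QuarticAlgorithm.matrixM (mulCoeff ω) t).transpose 1) →
        IsUnit V.det ∧
        QuarticAlgorithm.denK V t ≠ 0 ∧
        ∃ k : ℤ, k * QuarticAlgorithm.denK V t = QuarticAlgorithm.numK (mulCoeff ω) t ∧
          Parametrizes (QuarticAlgorithm.formA k V) (QuarticAlgorithm.formB V) ω := by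
  obtain ⟨t₀, ht₀⟩ := exists_isCase hω
  refine ⟨⟨t₀, ht₀, fun t ht => isCase_unique ht ht₀⟩, fun t ht => ⟨?_, fun U V hUV => ?_⟩⟩
  · obtain ⟨H, hH⟩ := exists_isRowHermiteFormOf
      (beside (matrixM (mulCoeff ω) t).transpose (1 : Matrix (Fin 6) (Fin 6) ℤ))
    obtain ⟨U, V, rfl⟩ := exists_eq_beside H
    exact ⟨U, V, hH⟩
  · have hdet := hUV.beside_one.1
    have hV : V 5 0 = 0 := by
      rw [← beside_natAdd U V]
      exact hUV.1.apply_eq_zero_of_lt (by decide)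
    have htab := hω.isNormalizedTable
    have hsr : tableBivector (mulCoeff ω) (freeColumns t).1 (freeColumns t).2 ≠ 0 := by
      rw [tableBivector_freeColumns]
      exact numK_ne_zero ht
    have hpl := htab.tableBivector_mul (s := (freeColumns t).1) (r := (freeColumns t).2)
      (by cases t <;> decide)
    -- The last two rows of `V` lie in the kernel of `matrixM`, so that the bivector of the table is
    -- proportional to their minors, and an integral multiple since `V` is unimodular.
    obtain ⟨hne, k, hk, hkV⟩ := exists_eq_mul_minor hdet (a := 4) (b := 5) (by decide) hsr
      (plucker_mul_minor hsr hpl (kernel_equations ht (hUV.mulVec_row_eq_zero (i := 4) le_rfl))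
        (kernel_equations ht (hUV.mulVec_row_eq_zero (i := 5) (by decide))))
    rw [← denK_eq hV] at hne hk
    rw [tableBivector_freeColumns] at hk
    exact ⟨hdet, hne, k, hk, hω.1, isTableOfPair htab hV hkV⟩
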